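/- **Theorem 2.** Let $X_1,X_2,\ldots$ be i.i.d. real-valued random variables with distribution $F$, let $m\ge 1$, and let $h:\mathbb{R}^m\to\mathbb{R}$ be a Borel-measurable kernel that is symmetric in its arguments. Suppose that $\mathbb{E}|h(X_1,\ldots,X_m)|^{5/3}<\infty$, that $\theta:=\int_{\mathbb{R}^m}h\,dF\cdots dF=0$, and that, with $\tilde h_1(x):=\mathbb{E}\big(h(X_1,\ldots,X_m)-\theta\,\big|\,X_1=x\big)$, the i.i.d. sequence $\tilde h_1(X_1),\tilde h_1(X_2),\ldots$ is in the domain of attraction of the normal law (DAN), i.e. there are constants $A_n$ and $B_n>0$ such that $B_n^{-1}\big(\sum_{i=1}^n\tilde h_1(X_i)-A_n\big)$ converges in distribution to $N(0,1)$. Write $[n]^{-k}:=(n-k)!/n!$. Then, as $n\to\infty$, $$\Big|\,[n]^{-2m+1}\sum h(X_{i_1},X_{i_2},\ldots,X_{i_m})\,h(X_{i_1},X_{i_{m+1}},\ldots,X_{i_{2m-1}})-\frac1n\sum_{i=1}^n\tilde h_1^2(X_i)\Big|=o_P(1),$$ where the first sum is over all $(2m-1)$-tuples $(i_1,\ldots,i_{2m-1})$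 of pairwise distinct indices in $\{1,\ldots,n\}$, and $o_P(1)$ denotes a sequence that converges to $0$ in probability. -/

import Mathlib

open MeasureTheory ProbabilityTheory Filter
open scoped Nat

noncomputable section

namespace UStat

variable {Ω : Type*} [MeasurableSpace Ω]

/-- The sequence `Y 0, Y 1, …` is in the domain of attraction of the normal law (DAN): there are
constants `A n` and `B n > 0` such that `(∑_{i<n} Y i - A n) / B n` converges in distribution
to a standard normal variable. -/
def IsDAN (P : Measure Ω) [IsProbabilityMeasure P] (Y : ℕ → Ω → ℝ) : Prop :=
  ∃ A B : ℕ → ℝ, (∀ n, 0 < B n) ∧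
    TendstoInDistribution (fun (n : ℕ) (ω : Ω) => (∑ i ∈ Finset.range n, Y i ω - A n) / B n)
      atTop (id : ℝ → ℝ) (fun _ => P) (gaussianReal 0 1)

/-- The kernel `h` of `m` real arguments is symmetric. -/
def IsSymmKernel {m : ℕ} (h : (Fin m → ℝ) → ℝ) : Prop :=
  ∀ (σ : Equiv.Perm (Fin m)) (x : Fin m → ℝ), h (fun j => x (σ j)) = h x

/-- The first `m` observations `(X_1, …, X_m)`, stored as `X 0, …, X (m - 1)`. -/
def firstObs (m : ℕ) (X : ℕ → Ω → ℝ) (ω : Ω) : Fin m → ℝ := fun j => X j ω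

/-- The parameter `θ = ∫ h dF ⋯ dF`, where `F` is the law of `X_1`. -/
def theta (P : Measure Ω) (X : ℕ → Ω → ℝ) {m : ℕ} (h : (Fin m → ℝ) → ℝ) : ℝ :=
  ∫ x, h x ∂(Measure.pi fun _ : Fin m => P.map (X 0))

/-- The projection `h̃₁(x) = E (h(X_1, …, X_m) - θ | X_1 = x)`: the integral of `h - θ` against the
conditional law of `(X_1, …, X_m)` given `X_1 = x`. -/
def proj (P : Measure Ω) [IsFiniteMeasure P] (X : ℕ → Ω → ℝ) {m : ℕ}
    (h : (Fin m → ℝ) → ℝ) (x : ℝ) : ℝ :=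
  ∫ v, (h v - theta P X h) ∂(condDistrib (firstObs m X) (X 0) P x)

/-- `[n]^{-k} = (n - k)! / n!`, used for `k ≤ n`. -/
def invFalling (n k : ℕ) : ℝ := ((n - k)! : ℝ) / (n ! : ℝ)

/-- Positions of `i_1, i_2, …, i_m` in `(i_1, …, i_{2m-1})`. -/
def leftPos (m : ℕ) (j : Fin m) : Fin (2 * m - 1) := ⟨j, by omega⟩

/-- Positions of `i_1, i_{m+1}, …, i_{2m-1}` in `(i_1, …, i_{2m-1})`. -/
def rightPos (m : ℕ) (j : Fin m) : Fin (2 * m - 1) :=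
  ⟨if (j : ℕ) = 0 then 0 else m - 1 + j, by split_ifs <;> omega⟩

/-- The statistic `[n]^{-2m+1} ∑ h(X_{i_1}, X_{i_2}, …, X_{i_m}) h(X_{i_1}, X_{i_{m+1}}, …,
X_{i_{2m-1}})`, the sum being over all `(2m-1)`-tuples of pairwise distinct indices among `n`. -/
def crossStat (X : ℕ → Ω → ℝ) {m : ℕ} (h : (Fin m → ℝ) → ℝ) (n : ℕ) (ω : Ω) : ℝ :=
  invFalling n (2 * m - 1) *
    ∑ i : Fin (2 * m - 1) ↪ Fin n,
      h (fun j => X (i (leftPos m j)) ω) * h (fun j => X (i (rightPos m j)) ω)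

end UStat

end

/-!
Conditionally on the shared observation `X_{i_1} = x`, the statistic is a U-statistic in two
disjoint blocks of further observations, with the product kernel `h(x, ·) h(x, ·)`; its centre is
`(∫ h(x, ·))²`. Averaging over permutations of the sample (Hoeffding) turns it into a mean of
products of two independent block means, each being the mean of order `N` i.i.d. terms. The von
Bahr–Esseen inequality then bounds its deviation from the centre in `L^{p/2}` by a multiple of
`N^{1/p-1}`, for `1 ≤ p ≤ 2`. Since `t ↦ t^{p/2}` is subadditive, averaging over the `N` possible
shared observations costs a factor `N^{1-p/2}` in the `p/2`-th absolute moment, which is then of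
order `N^{3/2-p}` and vanishes in the limit for `p > 3/2`.
-/

open scoped BigOperators ENNReal NNReal Topology

namespace UStat

section MomentInequality

lemma abs_one_add_rpow_le {p : ℝ} (hp1 : 1 ≤ p) (hp2 : p ≤ 2) (t : ℝ) :
    |1 + t| ^ p ≤ 1 + p * t + 3 * |t| ^ p := by
  have hp0 : 0 < p := by linarith
  rcases le_total t (-1) with ht | ht
  · have habs : |t| = -t := abs_of_nonpos (by linarith)
    have h1t : |1 + t| = -(1 + t) := abs_of_nonpos (by linarith)
    have h1 : |1 + t| ^ p ≤ |t| ^ p :=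
      Real.rpow_le_rpow (abs_nonneg _) (by linarith) hp0.le
    have h2 : |t| ≤ |t| ^ p := Real.self_le_rpow_of_one_le (by linarith) hp1
    nlinarith
  have h0 : 0 ≤ 1 + t := by linarith
  have hfac {s : ℝ} (hs : 0 ≤ s) : s ^ p = s * s ^ (p - 1) := by
    rw [← Real.rpow_one_add' hs (by linarith), add_sub_cancel]
  rw [abs_of_nonneg h0, hfac h0]
  rcases le_or_gt |t| 1 with h1 | h1
  · have hbern : (1 + t) ^ (p - 1) ≤ 1 + (p - 1) * t :=
      rpow_one_add_le_one_add_mul_self ht (by linarith) (by linarith)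
    have hsq : t ^ 2 ≤ |t| ^ p := by
      simpa using Real.rpow_le_rpow_of_exponent_ge' (abs_nonneg t) h1 hp0.le hp2
    nlinarith [mul_le_mul_of_nonneg_left hbern h0, sq_nonneg t]
  · have ht1 : 1 ≤ t := (lt_abs.1 h1).elim le_of_lt fun h => by linarith
    have ht0 : 0 ≤ t := by linarith
    have hsub : (1 + t) ^ (p - 1) ≤ 1 + t ^ (p - 1) := by
      simpa using Real.rpow_add_le_add_rpow zero_le_one ht0
        (by linarith : 0 ≤ p - 1) (by linarith)
    have hmono : t ^ (p - 1) ≤ t ^ p := Real.rpow_le_rpow_of_exponent_le ht1 (by linarith)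
    have hone : 1 ≤ t ^ p := Real.one_le_rpow ht1 hp0.le
    rw [abs_of_nonneg ht0]
    nlinarith [mul_le_mul_of_nonneg_left hsub h0, hfac ht0]

lemma abs_add_rpow_le {p : ℝ} (hp1 : 1 ≤ p) (hp2 : p ≤ 2) (a b : ℝ) :
    |a + b| ^ p ≤ |a| ^ p + p * (|a| ^ (p - 2) * a * b) + 3 * |b| ^ p := by
  rcases eq_or_ne a 0 with rfl | ha
  · have := Real.rpow_nonneg (abs_nonneg b) p
    simp only [zero_add, abs_zero, Real.zero_rpow (by linarith : p ≠ 0), mul_zero, zero_mul]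
    linarith
  have ha' : 0 < |a| := abs_pos.2 ha
  have hmul (c : ℝ) : |a| ^ p * |c| ^ p = |a * c| ^ p := by
    rw [← Real.mul_rpow ha'.le (abs_nonneg _), ← abs_mul]
  calc |a + b| ^ p = |a| ^ p * |1 + b / a| ^ p := by
        rw [hmul, mul_add, mul_one, mul_div_cancel₀ _ ha]
    _ ≤ |a| ^ p * (1 + p * (b / a) + 3 * |b / a| ^ p) := by
        gcongr
        exact abs_one_add_rpow_le hp1 hp2 _
    _ = |a| ^ p + p * (|a| ^ p / a ^ 2 * a * b) + 3 * (|a| ^ p * |b / a| ^ p) := by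
        field_simp
    _ = |a| ^ p + p * (|a| ^ (p - 2) * a * b) + 3 * |b| ^ p := by
        rw [hmul, mul_div_cancel₀ _ ha, Real.rpow_sub ha', Real.rpow_two, sq_abs]

variable {Ω : Type*} [MeasurableSpace Ω] {P : Measure Ω} {p : ℝ≥0}

lemma ofReal_integral_abs_rpow {f : Ω → ℝ} (hp : p ≠ 0) (hf : MemLp f p P) :
    ENNReal.ofReal (∫ ω, |f ω| ^ (p : ℝ) ∂P) = eLpNorm f p P ^ (p : ℝ) := by
  have hint : Integrable (fun ω => |f ω| ^ (p : ℝ)) P :=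
    hf.integrable_norm_rpow (by simpa using hp) ENNReal.coe_ne_top
  rw [eLpNorm_nnreal_pow_eq_lintegral hp, ofReal_integral_eq_lintegral_ofReal hint
    (ae_of_all _ fun ω => by positivity)]
  refine lintegral_congr fun ω => ?_
  rw [Real.enorm_eq_ofReal_abs, ENNReal.ofReal_rpow_of_nonneg (abs_nonneg _) p.coe_nonneg]

lemma integrable_abs_rpow_sub_two_mul [IsFiniteMeasure P] {S : Ω → ℝ} (hp1 : 1 ≤ p)
    (hS : MemLp S p P) : Integrable (fun ω => |S ω| ^ ((p : ℝ) - 2) * S ω) P := by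
  have hint : Integrable (fun ω => |S ω| ^ (p : ℝ)) P :=
    hS.integrable_norm_rpow (by positivity) ENNReal.coe_ne_top
  have hmeas : Measurable fun a : ℝ => |a| ^ ((p : ℝ) - 2) * a := by fun_prop
  refine (hint.add (integrable_const 1)).mono'
    (hmeas.comp_aemeasurable hS.1.aemeasurable).aestronglyMeasurable (ae_of_all _ fun ω => ?_)
  have hp1' : 0 ≤ (p : ℝ) - 1 := sub_nonneg.2 hp1
  have hpow := Real.rpow_nonneg (abs_nonneg (S ω)) p
  rcases eq_or_ne (S ω) 0 with h0 | h0
  · simpa [h0] using add_nonneg (Real.rpow_nonneg le_rfl _) zero_le_one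
  have habs : 0 < |S ω| := abs_pos.2 h0
  calc ‖|S ω| ^ ((p : ℝ) - 2) * S ω‖ = |S ω| ^ ((p : ℝ) - 1) := by
        rw [norm_mul, Real.norm_eq_abs, Real.norm_eq_abs, Real.abs_rpow_of_nonneg habs.le,
          abs_abs, ← Real.rpow_add_one habs.ne']
        ring_nf
    _ ≤ |S ω| ^ (p : ℝ) + 1 := by
        rcases le_total |S ω| 1 with h | h
        · linarith [Real.rpow_le_one habs.le h hp1']
        · linarith [Real.rpow_le_rpow_of_exponent_le h (by linarith : (p : ℝ) - 1 ≤ p)]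

lemma eLpNorm_add_rpow_le_of_indepFun [IsProbabilityMeasure P] (hp1 : 1 ≤ p) (hp2 : p ≤ 2)
    {S Y : Ω → ℝ} (hS : MemLp S p P) (hY : MemLp Y p P) (hSY : IndepFun S Y P)
    (hY0 : ∫ ω, Y ω ∂P = 0) :
    eLpNorm (S + Y) p P ^ (p : ℝ) ≤ eLpNorm S p P ^ (p : ℝ) + 3 * eLpNorm Y p P ^ (p : ℝ) := by
  have hp0 : p ≠ 0 := (zero_lt_one.trans_le hp1).ne'
  have hint {Z : Ω → ℝ} (hZ : MemLp Z p P) : Integrable (fun ω => |Z ω| ^ (p : ℝ)) P :=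
    hZ.integrable_norm_rpow (by simpa using hp0) ENNReal.coe_ne_top
  set g : ℝ → ℝ := fun a => |a| ^ ((p : ℝ) - 2) * a
  have hYi : Integrable Y P := hY.integrable (by exact_mod_cast hp1)
  have hgi : Integrable (fun ω => g (S ω)) P := integrable_abs_rpow_sub_two_mul hp1 hS
  have hind : IndepFun (fun ω => g (S ω)) Y P :=
    hSY.comp (by fun_prop : Measurable g) measurable_id
  have hgY : Integrable (fun ω => g (S ω) * Y ω) P := hind.integrable_mul hgi hYi
  have hcross : ∫ ω, g (S ω) * Y ω ∂P = 0 := by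
    rw [hind.integral_fun_mul_eq_mul_integral hgi.1 hYi.1, hY0, mul_zero]
  have hreal : ∫ ω, |(S + Y) ω| ^ (p : ℝ) ∂P
      ≤ ∫ ω, |S ω| ^ (p : ℝ) ∂P + 3 * ∫ ω, |Y ω| ^ (p : ℝ) ∂P := by
    calc ∫ ω, |(S + Y) ω| ^ (p : ℝ) ∂P
        ≤ ∫ ω, (|S ω| ^ (p : ℝ) + p * (g (S ω) * Y ω) + 3 * |Y ω| ^ (p : ℝ)) ∂P :=
          integral_mono (hint (hS.add hY))
            (((hint hS).add (hgY.const_mul p)).add ((hint hY).const_mul 3))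
            fun ω => abs_add_rpow_le hp1 hp2 (S ω) (Y ω)
      _ = ∫ ω, |S ω| ^ (p : ℝ) ∂P + 3 * ∫ ω, |Y ω| ^ (p : ℝ) ∂P := by
          rw [integral_add (by exact (hint hS).add (hgY.const_mul p)) ((hint hY).const_mul 3),
            integral_add (hint hS) (hgY.const_mul p), integral_const_mul, integral_const_mul,
            hcross, mul_zero, add_zero]
  rw [← ofReal_integral_abs_rpow hp0 (hS.add hY), ← ofReal_integral_abs_rpow hp0 hS,
    ← ofReal_integral_abs_rpow hp0 hY, ← ENNReal.ofReal_ofNat 3,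
    ← ENNReal.ofReal_mul (by positivity), ← ENNReal.ofReal_add (by positivity) (by positivity)]
  exact ENNReal.ofReal_le_ofReal hreal

-- The von Bahr–Esseen inequality, up to the value of the constant.
lemma eLpNorm_sum_rpow_le_of_iIndepFun (hp1 : 1 ≤ p) (hp2 : p ≤ 2) {ι : Type*}
    {Y : ι → Ω → ℝ} (hind : iIndepFun Y P) (hm : ∀ i, Measurable (Y i))
    (hY : ∀ i, MemLp (Y i) p P) (hY0 : ∀ i, ∫ ω, Y i ω ∂P = 0) (s : Finset ι) :
    eLpNorm (∑ i ∈ s, Y i) p P ^ (p : ℝ) ≤ 3 * ∑ i ∈ s, eLpNorm (Y i) p P ^ (p : ℝ) := by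
  classical
  have := hind.isProbabilityMeasure
  induction s using Finset.induction_on with
  | empty => simp [zero_lt_one.trans_le hp1]
  | insert a s ha ih =>
    rw [Finset.sum_insert ha, Finset.sum_insert ha, add_comm (Y a), mul_add, add_comm (3 * _)]
    calc eLpNorm (∑ i ∈ s, Y i + Y a) p P ^ (p : ℝ)
        ≤ eLpNorm (∑ i ∈ s, Y i) p P ^ (p : ℝ) + 3 * eLpNorm (Y a) p P ^ (p : ℝ) :=
          eLpNorm_add_rpow_le_of_indepFun hp1 hp2 (memLp_finsetSum' s fun i _ => hY i) (hY a)
            (hind.indepFun_finsetSum_of_notMem hm ha) (hY0 a)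
      _ ≤ 3 * ∑ i ∈ s, eLpNorm (Y i) p P ^ (p : ℝ) + 3 * eLpNorm (Y a) p P ^ (p : ℝ) := by gcongr

end MomentInequality

section IndependentMeans

variable {Ω 𝒱 : Type*} [MeasurableSpace Ω] [MeasurableSpace 𝒱] {P : Measure Ω} {ν : Measure 𝒱}

lemma eLpNorm_expect_le {ι : Type*} [Fintype ι] {q : ℝ≥0∞} (hq : 1 ≤ q) {f : ι → Ω → ℝ}
    (hf : ∀ i, AEStronglyMeasurable (f i) P) {B : ℝ≥0∞} (hB : ∀ i, eLpNorm (f i) q P ≤ B) :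
    eLpNorm (fun ω => 𝔼 i, f i ω) q P ≤ B := by
  have hmean : (fun ω => 𝔼 i, f i ω) = (Fintype.card ι : ℝ)⁻¹ • ∑ i, f i := by
    ext ω
    simp only [Fintype.expect_eq_sum_div_card, Pi.smul_apply, Finset.sum_apply, smul_eq_mul,
      div_eq_inv_mul]
  rw [hmean, eLpNorm_const_smul]
  rcases isEmpty_or_nonempty ι with hι | hι
  · simp
  have hcard : (Fintype.card ι : ℝ) ≠ 0 := by exact_mod_cast Fintype.card_ne_zero
  calc ‖(Fintype.card ι : ℝ)⁻¹‖ₑ * eLpNorm (∑ i, f i) q P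
      ≤ ‖(Fintype.card ι : ℝ)⁻¹‖ₑ * ∑ _i : ι, B := by
        gcongr
        exact (eLpNorm_sum_le (fun i _ => hf i) hq).trans (Finset.sum_le_sum fun i _ => hB i)
    _ = B := by
        rw [Finset.sum_const, Finset.card_univ, nsmul_eq_mul, ← mul_assoc, enorm_inv hcard,
          Real.enorm_natCast, ENNReal.inv_mul_cancel (by simp) (ENNReal.natCast_ne_top _), one_mul]

lemma enorm_integral_le_eLpNorm [IsProbabilityMeasure ν] {u : 𝒱 → ℝ} {q : ℝ≥0∞} (hq : 1 ≤ q)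
    (hu : AEStronglyMeasurable u ν) : ‖∫ v, u v ∂ν‖ₑ ≤ eLpNorm u q ν :=
  calc ‖∫ v, u v ∂ν‖ₑ ≤ ∫⁻ v, ‖u v‖ₑ ∂ν := enorm_integral_le_lintegral_enorm _
    _ = eLpNorm u 1 ν := eLpNorm_one_eq_lintegral_enorm.symm
    _ ≤ eLpNorm u q ν := eLpNorm_le_eLpNorm_of_exponent_le hq hu

lemma eLpNorm_sub_integral_le [IsProbabilityMeasure ν] {u : 𝒱 → ℝ} {q : ℝ≥0∞} (hq : 1 ≤ q)
    (hu : AEStronglyMeasurable u ν) :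
    eLpNorm (fun v => u v - ∫ v, u v ∂ν) q ν ≤ 2 * eLpNorm u q ν :=
  calc eLpNorm (fun v => u v - ∫ v, u v ∂ν) q ν
      ≤ eLpNorm u q ν + eLpNorm (fun _ => ∫ v, u v ∂ν) q ν :=
        eLpNorm_sub_le hu aestronglyMeasurable_const hq
    _ = eLpNorm u q ν + ‖∫ v, u v ∂ν‖ₑ := by
        rw [eLpNorm_const _ (one_pos.trans_le hq).ne' (IsProbabilityMeasure.ne_zero ν),
          measure_univ, ENNReal.one_rpow, mul_one]
    _ ≤ 2 * eLpNorm u q ν := by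
        rw [two_mul]
        gcongr
        exact enorm_integral_le_eLpNorm hq hu

variable {p : ℝ≥0} {β : Type*} [Fintype β] {u : 𝒱 → ℝ}

lemma eLpNorm_sum_comp_eval_le [IsProbabilityMeasure ν] (hp1 : 1 ≤ p) (hp2 : p ≤ 2)
    (hum : Measurable u) (hu : MemLp u p ν) (hu0 : ∫ v, u v ∂ν = 0) :
    eLpNorm (fun y : β → 𝒱 => ∑ b, u (y b)) p (Measure.pi fun _ => ν)
      ≤ 3 * (Fintype.card β : ℝ≥0∞) ^ (p : ℝ)⁻¹ * eLpNorm u p ν := by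
  have hp0 : 0 < (p : ℝ) := zero_lt_one.trans_le hp1
  have heval (b : β) : MeasurePreserving (Function.eval b) (Measure.pi fun _ : β => ν) ν :=
    measurePreserving_eval _ b
  have hnorm (b : β) :
      eLpNorm (fun y : β → 𝒱 => u (y b)) p (Measure.pi fun _ => ν) = eLpNorm u p ν :=
    eLpNorm_comp_measurePreserving hu.1 (heval b)
  have hsum := eLpNorm_sum_rpow_le_of_iIndepFun hp1 hp2
    (iIndepFun_pi (μ := fun _ : β => ν) (X := fun _ => u) fun _ => hum.aemeasurable)
    (fun b => by fun_prop) (fun b => hu.comp_measurePreserving (heval b))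
    (fun b => (integral_comp_eval hum.aestronglyMeasurable).trans hu0) Finset.univ
  simp only [hnorm, Finset.sum_const, Finset.card_univ, nsmul_eq_mul] at hsum
  calc eLpNorm (fun y : β → 𝒱 => ∑ b, u (y b)) p (Measure.pi fun _ => ν)
      = eLpNorm (∑ b, fun y : β → 𝒱 => u (y b)) p (Measure.pi fun _ => ν) := by
        rw [Finset.sum_fn]
    _ ≤ (3 * (Fintype.card β * eLpNorm u p ν ^ (p : ℝ))) ^ (p : ℝ)⁻¹ :=
        (ENNReal.le_rpow_inv_iff hp0).2 hsum
    _ = 3 ^ (p : ℝ)⁻¹ * (Fintype.card β : ℝ≥0∞) ^ (p : ℝ)⁻¹ * eLpNorm u p ν := by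
        have hinv : 0 ≤ (p : ℝ)⁻¹ := inv_nonneg.2 hp0.le
        rw [ENNReal.mul_rpow_of_nonneg _ _ hinv, ENNReal.mul_rpow_of_nonneg _ _ hinv,
          ENNReal.rpow_rpow_inv hp0.ne', mul_assoc]
    _ ≤ 3 * (Fintype.card β : ℝ≥0∞) ^ (p : ℝ)⁻¹ * eLpNorm u p ν := by
        gcongr
        simpa using ENNReal.rpow_le_rpow_of_exponent_le (by norm_num : (1 : ℝ≥0∞) ≤ 3)
          (inv_le_one_of_one_le₀ hp1 : (p : ℝ)⁻¹ ≤ 1)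

variable [Nonempty β]

lemma eLpNorm_expect_sub_integral_le [IsProbabilityMeasure ν] (hp1 : 1 ≤ p) (hp2 : p ≤ 2)
    (hum : Measurable u) (hu : MemLp u p ν) :
    eLpNorm (fun y : β → 𝒱 => 𝔼 b, u (y b) - ∫ v, u v ∂ν) p (Measure.pi fun _ => ν)
      ≤ 6 * (Fintype.card β : ℝ≥0∞) ^ ((p : ℝ)⁻¹ - 1) * eLpNorm u p ν := by
  have hpe : (1 : ℝ≥0∞) ≤ p := by exact_mod_cast hp1
  set w : 𝒱 → ℝ := fun v => u v - ∫ v, u v ∂ν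
  have hw0 : ∫ v, w v ∂ν = 0 := by
    simp only [w, integral_sub (hu.integrable hpe) (integrable_const _), integral_const,
      probReal_univ, one_smul, sub_self]
  have hmean : (fun y : β → 𝒱 => 𝔼 b, u (y b) - ∫ v, u v ∂ν)
      = (Fintype.card β : ℝ)⁻¹ • fun y : β → 𝒱 => ∑ b, w (y b) := by
    ext y
    rw [Pi.smul_apply, smul_eq_mul, ← div_eq_inv_mul, ← Fintype.expect_eq_sum_div_card,
      Finset.expect_sub_distrib, Fintype.expect_const]
  have hcard : (Fintype.card β : ℝ) ≠ 0 := by exact_mod_cast Fintype.card_ne_zero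
  calc eLpNorm (fun y : β → 𝒱 => 𝔼 b, u (y b) - ∫ v, u v ∂ν) p (Measure.pi fun _ => ν)
      = (Fintype.card β : ℝ≥0∞)⁻¹
        * eLpNorm (fun y : β → 𝒱 => ∑ b, w (y b)) p (Measure.pi fun _ => ν) := by
        rw [hmean, eLpNorm_const_smul, enorm_inv hcard, Real.enorm_natCast]
    _ ≤ (Fintype.card β : ℝ≥0∞)⁻¹
        * (3 * (Fintype.card β : ℝ≥0∞) ^ (p : ℝ)⁻¹ * (2 * eLpNorm u p ν)) := by
        gcongr
        exact (eLpNorm_sum_comp_eval_le hp1 hp2 (by fun_prop) (hu.sub (memLp_const _)) hw0).trans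
          (by gcongr; exact eLpNorm_sub_integral_le hpe hu.1)
    _ = 6 * (Fintype.card β : ℝ≥0∞) ^ ((p : ℝ)⁻¹ - 1) * eLpNorm u p ν := by
        rw [ENNReal.rpow_sub _ _ (by simp) (ENNReal.natCast_ne_top _), ENNReal.rpow_one,
          div_eq_mul_inv]
        ring

lemma eLpNorm_mul_of_indepFun (hp : p ≠ 0) {S T : Ω → ℝ} (hS : Measurable S) (hT : Measurable T)
    (hST : IndepFun S T P) : eLpNorm (S * T) p P = eLpNorm S p P * eLpNorm T p P := by
  have hpow : Measurable fun s : ℝ => ‖s‖ₑ ^ (p : ℝ) := by fun_prop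
  have hp0 : (p : ℝ) ≠ 0 := by exact_mod_cast hp
  refine ENNReal.rpow_left_injective hp0 ?_
  simp only [ENNReal.mul_rpow_of_nonneg _ _ p.coe_nonneg, eLpNorm_nnreal_pow_eq_lintegral hp,
    Pi.mul_apply, enorm_mul]
  exact lintegral_mul_eq_lintegral_mul_lintegral_of_indepFun (hpow.comp hS) (hpow.comp hT)
    (hST.comp hpow hpow)

lemma eLpNorm_mul_sub_sq_le_of_indepFun (hp1 : 1 ≤ p) {S T : Ω → ℝ} (hS : Measurable S)
    (hT : Measurable T) (hST : IndepFun S T P) (c : ℝ) {δ : ℝ≥0∞}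
    (hSδ : eLpNorm (fun ω => S ω - c) p P ≤ δ) (hTδ : eLpNorm (fun ω => T ω - c) p P ≤ δ) :
    eLpNorm (fun ω => S ω * T ω - c ^ 2) p P ≤ δ * δ + 2 * ‖c‖ₑ * δ := by
  have hpe : (1 : ℝ≥0∞) ≤ p := by exact_mod_cast hp1
  have hsub : Measurable fun s : ℝ => s - c := by fun_prop
  set S' : Ω → ℝ := fun ω => S ω - c
  set T' : Ω → ℝ := fun ω => T ω - c
  have hS' : Measurable S' := hsub.comp hS
  have hT' : Measurable T' := hsub.comp hT
  have hexp : (fun ω => S ω * T ω - c ^ 2) = S' * T' + (c • S' + c • T') := by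
    ext ω
    simp only [S', T', Pi.add_apply, Pi.mul_apply, Pi.smul_apply, smul_eq_mul]
    ring
  calc eLpNorm (fun ω => S ω * T ω - c ^ 2) p P
      ≤ eLpNorm (S' * T') p P + (eLpNorm (c • S') p P + eLpNorm (c • T') p P) := by
        rw [hexp]
        refine (eLpNorm_add_le (by fun_prop) (by fun_prop) hpe).trans ?_
        gcongr
        exact eLpNorm_add_le (by fun_prop) (by fun_prop) hpe
    _ = eLpNorm S' p P * eLpNorm T' p P + (‖c‖ₑ * eLpNorm S' p P + ‖c‖ₑ * eLpNorm T' p P) := by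
        rw [eLpNorm_mul_of_indepFun (zero_lt_one.trans_le hp1).ne' hS' hT' (hST.comp hsub hsub),
          eLpNorm_const_smul, eLpNorm_const_smul]
    _ ≤ δ * δ + (‖c‖ₑ * δ + ‖c‖ₑ * δ) := by gcongr
    _ = δ * δ + 2 * ‖c‖ₑ * δ := by ring

lemma eLpNorm_expect_mul_expect_sub_sq_le [IsProbabilityMeasure ν] (hp1 : 1 ≤ p) (hp2 : p ≤ 2)
    (hum : Measurable u) (hu : MemLp u p ν) :
    eLpNorm (fun y : (β → 𝒱) × (β → 𝒱) =>
        (𝔼 b, u (y.1 b)) * (𝔼 b, u (y.2 b)) - (∫ v, u v ∂ν) ^ 2) p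
        ((Measure.pi fun _ => ν).prod (Measure.pi fun _ => ν))
      ≤ 48 * (Fintype.card β : ℝ≥0∞) ^ ((p : ℝ)⁻¹ - 1) * eLpNorm u p ν ^ 2 := by
  set W := eLpNorm u p ν
  set r := (Fintype.card β : ℝ≥0∞) ^ ((p : ℝ)⁻¹ - 1)
  set c := ∫ v, u v ∂ν
  set M : (β → 𝒱) → ℝ := fun y => 𝔼 b, u (y b)
  have hM : Measurable M := by
    simp only [M, Fintype.expect_eq_sum_div_card]
    fun_prop
  have hMc : AEStronglyMeasurable (fun y => M y - c) (Measure.pi fun _ => ν) :=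
    (hM.sub_const c).aestronglyMeasurable
  have hδ : eLpNorm (fun y => M y - c) p (Measure.pi fun _ => ν) ≤ 6 * r * W :=
    eLpNorm_expect_sub_integral_le hp1 hp2 hum hu
  have hc : ‖c‖ₑ ≤ W := enorm_integral_le_eLpNorm (by exact_mod_cast hp1) hu.1
  have hr : r ≤ 1 := by
    simpa using ENNReal.rpow_le_rpow_of_exponent_le (x := Fintype.card β) (y := (p : ℝ)⁻¹ - 1)
      (z := 0) (by exact_mod_cast Fintype.card_pos) (sub_nonpos.2 (inv_le_one_of_one_le₀ hp1))
  calc _ ≤ 6 * r * W * (6 * r * W) + 2 * ‖c‖ₑ * (6 * r * W) :=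
        eLpNorm_mul_sub_sq_le_of_indepFun hp1 (hM.comp measurable_fst) (hM.comp measurable_snd)
          (indepFun_prod hM hM) c
          ((eLpNorm_comp_measurePreserving hMc measurePreserving_fst).trans_le hδ)
          ((eLpNorm_comp_measurePreserving hMc measurePreserving_snd).trans_le hδ)
    _ ≤ 6 * r * W * (6 * 1 * W) + 2 * W * (6 * r * W) := by gcongr
    _ = 48 * r * W ^ 2 := by ring

end IndependentMeans

section Blocks

variable {E ι κ : Type*} [MeasurableSpace E] [Fintype ι] [Fintype κ] (μ : Measure E)
  [IsProbabilityMeasure μ]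

lemma measurePreserving_comp_embedding (e : κ ↪ ι) :
    MeasurePreserving (fun (z : ι → E) (j : κ) => z (e j)) (Measure.pi fun _ => μ)
      (Measure.pi fun _ => μ) := by
  refine ⟨by fun_prop, ?_⟩
  have hind : iIndepFun (fun (i : ι) (z : ι → E) => z i) (Measure.pi fun _ => μ) :=
    iIndepFun_pi (X := fun _ => id) fun _ => aemeasurable_id
  rw [(hind.precomp e.injective).map_fun_eq_pi_map fun j => (measurable_pi_apply _).aemeasurable]
  congr with j : 1
  exact (measurePreserving_eval (fun _ : ι => μ) (e j)).map_eq

lemma measurePreserving_pi_curry :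
    MeasurePreserving (fun (z : ι × κ → E) (i : ι) (j : κ) => z (i, j)) (Measure.pi fun _ => μ)
      (Measure.pi fun _ => Measure.pi fun _ => μ) := by
  refine ⟨by fun_prop, ?_⟩
  have hcurry := Measure.infinitePi_map_curry fun (_ : ι) (_ : κ) => μ
  simp only [Measure.infinitePi_eq_pi] at hcurry
  exact hcurry

lemma measurePreserving_blocks {β : Type*} [Fintype β] (e : (β ⊕ β) × κ ↪ ι) :
    MeasurePreserving
      (fun z : ι → E => ((fun b j => z (e (.inl b, j))), (fun b j => z (e (.inr b, j)))))
      (Measure.pi fun _ => μ)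
      ((Measure.pi fun _ : β => Measure.pi fun _ : κ => μ).prod
        (Measure.pi fun _ : β => Measure.pi fun _ : κ => μ)) :=
  (measurePreserving_sumPiEquivProdPi fun _ : β ⊕ β => Measure.pi fun _ : κ => μ).comp
    ((measurePreserving_pi_curry μ).comp (measurePreserving_comp_embedding μ e))

end Blocks

section PairMean

lemma expect_embedding_eq_expect_perm {κ α : Type*} [Fintype κ] [Fintype α]
    [DecidableEq α] (e : κ ↪ α) (G : (κ ↪ α) → ℝ) :
    𝔼 f, G f = 𝔼 σ : Equiv.Perm α, G (e.trans σ.toEmbedding) := by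
  have : Nonempty (κ ↪ α) := ⟨e⟩
  calc 𝔼 f, G f = 𝔼 σ : Equiv.Perm α, 𝔼 f : κ ↪ α, G (f.trans σ.toEmbedding) := by
        rw [← Fintype.expect_const (ι := Equiv.Perm α) (𝔼 f, G f)]
        exact Finset.expect_congr rfl fun σ _ => (Fintype.expect_equiv
          (Equiv.embeddingCongr (Equiv.refl κ) σ) _ _ fun f => rfl).symm
    _ = 𝔼 f : κ ↪ α, 𝔼 σ : Equiv.Perm α, G (f.trans σ.toEmbedding) := Finset.expect_comm ..
    _ = 𝔼 _f : κ ↪ α, 𝔼 σ : Equiv.Perm α, G (e.trans σ.toEmbedding) := by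
        refine Finset.expect_congr rfl fun f _ => ?_
        obtain ⟨τ, rfl⟩ := Equiv.Perm.exists_smul_eq_embedding e f
        exact Fintype.expect_equiv (Equiv.mulRight τ) _ _ fun σ => rfl
    _ = 𝔼 σ : Equiv.Perm α, G (e.trans σ.toEmbedding) := Fintype.expect_const _

variable {E κ α : Type*} [Fintype κ] [Fintype α]

/-- The two-block U-statistic of `u`: the mean of the products of the values of `u` at two disjoint
tuples of coordinates of `z`, a pair of disjoint tuples being encoded as an embedding of
`κ ⊕ κ`. -/
noncomputable def pairMean (u : (κ → E) → ℝ) (z : α → E) : ℝ :=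
  𝔼 f : κ ⊕ κ ↪ α, u (fun j => z (f (.inl j))) * u (fun j => z (f (.inr j)))

/-- The embedding of `κ ⊕ κ` given by the block `a` of the first half and the block `b` of the
second half of a family of disjoint blocks `e`. -/
def blockPair {β : Type*} (e : (β ⊕ β) × κ ↪ α) (a b : β) : κ ⊕ κ ↪ α :=
  ⟨Sum.elim (fun j => e (.inl a, j)) (fun j => e (.inr b, j)), by
    rintro (i | i) (j | j) <;> simp⟩

-- Hoeffding's device: a U-statistic is an average of means over disjoint blocks.
lemma pairMean_eq_expect_perm {β : Type*} [DecidableEq α] [Fintype β] [Nonempty β]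
    (u : (κ → E) → ℝ) (e : (β ⊕ β) × κ ↪ α) (z : α → E) :
    pairMean u z = 𝔼 σ : Equiv.Perm α,
      (𝔼 a, u (fun j => z (σ (e (.inl a, j))))) * (𝔼 b, u (fun j => z (σ (e (.inr b, j))))) := by
  have hblock (a b : β) : pairMean u z = 𝔼 σ : Equiv.Perm α,
      u (fun j => z (σ (e (.inl a, j)))) * u (fun j => z (σ (e (.inr b, j)))) :=
    expect_embedding_eq_expect_perm (blockPair e a b) _
  calc pairMean u z = 𝔼 _a : β, 𝔼 _b : β, pairMean u z := by simp only [Fintype.expect_const]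
    _ = 𝔼 a, 𝔼 b, 𝔼 σ : Equiv.Perm α,
          u (fun j => z (σ (e (.inl a, j)))) * u (fun j => z (σ (e (.inr b, j)))) :=
        Finset.expect_congr rfl fun a _ => Finset.expect_congr rfl fun b _ => hblock a b
    _ = _ := by
        simp only [Fintype.expect_mul_expect, ← Finset.expect_comm Finset.univ
          (Finset.univ : Finset (Equiv.Perm α))]

variable [MeasurableSpace E]

lemma measurable_pairMean {u : (κ → E) → ℝ} (hu : Measurable u) :
    Measurable (pairMean u : (α → E) → ℝ) := by
  unfold pairMean
  simp only [Fintype.expect_eq_sum_div_card]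
  fun_prop

lemma measurable_pairMean_uncurry {F : Type*} [MeasurableSpace F] {h : F → (κ → E) → ℝ}
    (hh : Measurable (Function.uncurry h)) :
    Measurable fun q : F × (α → E) => pairMean (h q.1) q.2 := by
  have hsel (s : κ → α) : Measurable fun q : F × (α → E) => h q.1 fun j => q.2 (s j) :=
    hh.comp (by fun_prop : Measurable fun q : F × (α → E) => (q.1, fun j => q.2 (s j)))
  simp only [pairMean, Fintype.expect_eq_sum_div_card]
  exact (Finset.measurable_sum _ fun f _ => (hsel _).mul (hsel _)).div_const _

variable (μ : Measure E) [IsProbabilityMeasure μ] {p : ℝ≥0} {u : (κ → E) → ℝ} {L : ℕ}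

lemma eLpNorm_pairMean_sub_sq_le (hp1 : 1 ≤ p) (hp2 : p ≤ 2) (hum : Measurable u)
    (hL : 0 < L) (hcard : 2 * L * Fintype.card κ ≤ Fintype.card α) :
    eLpNorm (fun z : α → E => pairMean u z - (∫ v, u v ∂(Measure.pi fun _ => μ)) ^ 2) p
        (Measure.pi fun _ => μ)
      ≤ 48 * (L : ℝ≥0∞) ^ ((p : ℝ)⁻¹ - 1) * eLpNorm u p (Measure.pi fun _ => μ) ^ 2 := by
  classical
  have : NeZero L := ⟨hL.ne'⟩
  rcases eq_or_ne (eLpNorm u p (Measure.pi fun _ => μ)) ∞ with hu | hu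
  · rw [hu, ENNReal.top_pow two_ne_zero, ENNReal.mul_top (by simp [hL.ne'])]
    exact le_top
  obtain ⟨e⟩ : Nonempty ((Fin L ⊕ Fin L) × κ ↪ α) :=
    Function.Embedding.nonempty_of_card_le (by simpa [two_mul] using hcard)
  set c := ∫ v, u v ∂(Measure.pi fun _ => μ)
  set Q : (Fin L → κ → E) × (Fin L → κ → E) → ℝ :=
    fun y => (𝔼 a, u (y.1 a)) * (𝔼 b, u (y.2 b)) - c ^ 2
  have hQ : Measurable Q := by
    simp only [Q, Fintype.expect_eq_sum_div_card]
    fun_prop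
  have hblocks (σ : Equiv.Perm α) := measurePreserving_blocks μ (e.trans σ.toEmbedding)
  have hrep : (fun z : α → E => pairMean u z - c ^ 2) = fun z => 𝔼 σ : Equiv.Perm α,
      Q (fun a j => z (σ (e (.inl a, j))), fun b j => z (σ (e (.inr b, j)))) := by
    ext z
    rw [Finset.expect_sub_distrib, Fintype.expect_const, pairMean_eq_expect_perm u e z]
  rw [hrep]
  refine eLpNorm_expect_le (by exact_mod_cast hp1)
    (fun σ => (hQ.comp (hblocks σ).measurable).aestronglyMeasurable) fun σ => ?_
  calc _ = eLpNorm Q p ((Measure.pi fun _ => Measure.pi fun _ => μ).prod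
          (Measure.pi fun _ => Measure.pi fun _ => μ)) :=
        eLpNorm_comp_measurePreserving hQ.aestronglyMeasurable (hblocks σ)
    _ ≤ _ := by
        simpa using eLpNorm_expect_mul_expect_sub_sq_le (β := Fin L) hp1 hp2 hum
          ⟨hum.aestronglyMeasurable, hu.lt_top⟩

lemma lintegral_pairMean_sub_sq_rpow_le (hp1 : 1 ≤ p) (hp2 : p ≤ 2) (hum : Measurable u)
    (hL : 0 < L) (hcard : 2 * L * Fintype.card κ ≤ Fintype.card α) :
    ∫⁻ z : α → E, ‖pairMean u z - (∫ v, u v ∂(Measure.pi fun _ => μ)) ^ 2‖ₑ ^ (p / 2 : ℝ)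
        ∂(Measure.pi fun _ => μ)
      ≤ (48 * (L : ℝ≥0∞) ^ ((p : ℝ)⁻¹ - 1)) ^ (p / 2 : ℝ)
        * ∫⁻ v, ‖u v‖ₑ ^ (p : ℝ) ∂(Measure.pi fun _ => μ) := by
  have hp0 : p ≠ 0 := (zero_lt_one.trans_le hp1).ne'
  have hhalf : ((p / 2 : ℝ≥0) : ℝ) = p / 2 := by push_cast; rfl
  rw [← hhalf, ← eLpNorm_nnreal_pow_eq_lintegral (by positivity),
    ← eLpNorm_nnreal_pow_eq_lintegral hp0]
  have hnorm := (eLpNorm_le_eLpNorm_of_exponent_le (ENNReal.coe_le_coe.2 (half_le_self p.2))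
    ((measurable_pairMean hum).sub_const _).aestronglyMeasurable).trans
      (eLpNorm_pairMean_sub_sq_le (α := α) μ hp1 hp2 hum hL hcard)
  refine (ENNReal.rpow_le_rpow hnorm (p / 2).coe_nonneg).trans_eq ?_
  rw [ENNReal.mul_rpow_of_nonneg _ _ (p / 2).coe_nonneg, ← ENNReal.rpow_two,
    ← ENNReal.rpow_mul, hhalf, mul_div_cancel₀ _ two_ne_zero]

end PairMean

section CrossMean

/-- Adjoin a point `a` to an embedding into the complement of `a`. -/
def consEmbedding {κ : Type*} {N : ℕ} (a : Fin (N + 1)) (f : κ ↪ Fin N) :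
    Option κ ↪ Fin (N + 1) :=
  (f.trans a.succAboveEmb).optionElim a (by simp [Fin.succAbove_ne])

lemma consEmbedding_bijective {κ : Type*} [Finite κ] {N : ℕ} :
    Function.Bijective fun q : Fin (N + 1) × (κ ↪ Fin N) => consEmbedding q.1 q.2 := by
  have := Fintype.ofFinite κ
  classical
  refine (Fintype.bijective_iff_injective_and_card _).2 ⟨?_, ?_⟩
  · rintro ⟨a, f⟩ ⟨b, g⟩ h
    obtain rfl : a = b := DFunLike.congr_fun h none
    have hfg : f = g := by
      ext1 j
      exact Fin.succAbove_right_injective (DFunLike.congr_fun h (some j))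
    rw [hfg]
  · simp only [Fintype.card_prod, Fintype.card_embedding_eq, Fintype.card_option, Fintype.card_fin,
      Nat.succ_descFactorial_succ]

variable {E κ : Type*} [Fintype κ] {N : ℕ} {h : E → (κ → E) → ℝ}

/-- The mean of the products of two values of the kernel `h` which share their first argument and
nothing else, taken over all choices of pairwise distinct coordinates of `x`. -/
noncomputable def crossMean {ι : Type*} [Fintype ι] (h : E → (κ → E) → ℝ) (x : ι → E) : ℝ :=
  𝔼 f : Option (κ ⊕ κ) ↪ ι, h (x (f none)) (fun j => x (f (some (.inl j))))
    * h (x (f none)) (fun j => x (f (some (.inr j))))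

lemma crossMean_eq_expect_pairMean (x : Fin (N + 1) → E) :
    crossMean h x = 𝔼 a, pairMean (h (x a)) fun j => x (a.succAbove j) := by
  simp only [pairMean, ← Finset.expect_product', Finset.univ_product_univ]
  exact (Fintype.expect_bijective _ consEmbedding_bijective _ _ fun _ => rfl).symm

lemma crossMean_sub_expect (x : Fin (N + 1) → E) (c : E → ℝ) :
    crossMean h x - 𝔼 a, c (x a)
      = 𝔼 a, (pairMean (h (x a)) (fun j => x (a.succAbove j)) - c (x a)) := by
  rw [crossMean_eq_expect_pairMean, Finset.expect_sub_distrib]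

lemma enorm_expect_rpow_le {ι : Type*} [Fintype ι] [Nonempty ι] {q : ℝ} (hq0 : 0 < q)
    (hq1 : q ≤ 1) (f : ι → ℝ) :
    ‖𝔼 i, f i‖ₑ ^ q ≤ (Fintype.card ι : ℝ≥0∞) ^ (-q) * ∑ i, ‖f i‖ₑ ^ q := by
  have hsum : ‖∑ i, f i‖ₑ ^ q ≤ ∑ i, ‖f i‖ₑ ^ q :=
    Finset.le_sum_of_subadditive (fun x : ℝ => ‖x‖ₑ ^ q) (by simp [hq0])
      (fun x y => (ENNReal.rpow_le_rpow (enorm_add_le x y) hq0.le).trans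
        (ENNReal.rpow_add_le_add_rpow _ _ hq0.le hq1)) _ _
  rw [Fintype.expect_eq_sum_div_card, div_eq_inv_mul, enorm_mul,
    enorm_inv (by simp), Real.enorm_natCast, ENNReal.mul_rpow_of_nonneg _ _ hq0.le,
    ENNReal.inv_rpow, ENNReal.rpow_neg]
  gcongr

variable [MeasurableSpace E]

lemma measurable_pairMean_sub_sq {F : Type*} [MeasurableSpace F] {α : Type*} [Fintype α]
    {h : F → (κ → E) → ℝ} (hh : Measurable (Function.uncurry h)) (ν : Measure (κ → E))
    [SFinite ν] :
    Measurable fun q : F × (α → E) => pairMean (h q.1) q.2 - (∫ v, h q.1 v ∂ν) ^ 2 := by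
  have hint : Measurable fun x => ∫ v, h x v ∂ν :=
    (StronglyMeasurable.integral_prod_right' hh.stronglyMeasurable).measurable
  exact (measurable_pairMean_uncurry hh).sub ((hint.comp measurable_fst).pow_const 2)

variable (μ : Measure E) [IsProbabilityMeasure μ] {p : ℝ≥0} {L : ℕ}

lemma measurable_crossMean_sub_expect_sq (hh : Measurable (Function.uncurry h))
    (ν : Measure (κ → E)) [SFinite ν] :
    Measurable fun x : Fin (N + 1) → E => crossMean h x - 𝔼 a, (∫ v, h (x a) v ∂ν) ^ 2 := by
  simp_rw [fun x : Fin (N + 1) → E =>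
    crossMean_sub_expect (h := h) x fun y => (∫ v, h y v ∂ν) ^ 2]
  simp only [Fintype.expect_eq_sum_div_card]
  have hsel (a : Fin (N + 1)) : Measurable fun x : Fin (N + 1) → E =>
      (x a, fun j : Fin N => x (a.succAbove j)) := by fun_prop
  exact (Finset.measurable_sum _ fun a _ =>
    (measurable_pairMean_sub_sq hh ν).comp (hsel a)).div_const _

lemma lintegral_pi_succAbove (a : Fin (N + 1)) {G : E × (Fin N → E) → ℝ≥0∞} (hG : Measurable G) :
    ∫⁻ x : Fin (N + 1) → E, G (x a, fun j => x (a.succAbove j)) ∂(Measure.pi fun _ => μ)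
      = ∫⁻ x, ∫⁻ z, G (x, z) ∂(Measure.pi fun _ => μ) ∂μ := by
  rw [← lintegral_prod _ hG.aemeasurable]
  exact (measurePreserving_piFinSuccAbove (fun _ : Fin (N + 1) => μ) a).lintegral_comp hG

lemma lintegral_pairMean_uncurry_sub_sq_rpow_le {α : Type*} [Fintype α] (hp1 : 1 ≤ p) (hp2 : p ≤ 2)
    (hh : Measurable (Function.uncurry h)) (hL : 0 < L)
    (hcard : 2 * L * Fintype.card κ ≤ Fintype.card α) :
    ∫⁻ x, ∫⁻ z : α → E,
        ‖pairMean (h x) z - (∫ v, h x v ∂(Measure.pi fun _ => μ)) ^ 2‖ₑ ^ (p / 2 : ℝ)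
        ∂(Measure.pi fun _ => μ) ∂μ
      ≤ (48 * (L : ℝ≥0∞) ^ ((p : ℝ)⁻¹ - 1)) ^ (p / 2 : ℝ)
        * ∫⁻ q, ‖Function.uncurry h q‖ₑ ^ (p : ℝ) ∂(μ.prod (Measure.pi fun _ => μ)) := by
  have hmoment : Measurable fun q => ‖Function.uncurry h q‖ₑ ^ (p : ℝ) := hh.enorm.pow_const _
  rw [lintegral_prod _ hmoment.aemeasurable, ← lintegral_const_mul _ hmoment.lintegral_prod_right']
  exact lintegral_mono fun x => lintegral_pairMean_sub_sq_rpow_le μ hp1 hp2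
    (hh.comp measurable_prodMk_left) hL hcard

lemma lintegral_crossMean_sub_expect_sq_rpow_le (hp1 : 1 ≤ p) (hp2 : p ≤ 2)
    (hh : Measurable (Function.uncurry h)) (hL : 0 < L) (hLN : 2 * L * Fintype.card κ ≤ N) :
    ∫⁻ x : Fin (N + 1) → E,
        ‖crossMean h x - 𝔼 a, (∫ v, h (x a) v ∂(Measure.pi fun _ => μ)) ^ 2‖ₑ ^ (p / 2 : ℝ)
        ∂(Measure.pi fun _ => μ)
      ≤ ((N + 1 : ℕ) : ℝ≥0∞) ^ (1 - p / 2 : ℝ)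
        * (48 * (L : ℝ≥0∞) ^ ((p : ℝ)⁻¹ - 1)) ^ (p / 2 : ℝ)
        * ∫⁻ q, ‖Function.uncurry h q‖ₑ ^ (p : ℝ) ∂(μ.prod (Measure.pi fun _ => μ)) := by
  have hq0 : (0 : ℝ) < p / 2 := half_pos (zero_lt_one.trans_le hp1)
  have hq1 : (p / 2 : ℝ) ≤ 1 := (div_le_one two_pos).2 (by exact_mod_cast hp2)
  set ν : Measure (κ → E) := Measure.pi fun _ => μ
  set K : ℝ≥0∞ := (48 * (L : ℝ≥0∞) ^ ((p : ℝ)⁻¹ - 1)) ^ (p / 2 : ℝ)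
  set I : ℝ≥0∞ := ∫⁻ q, ‖Function.uncurry h q‖ₑ ^ (p : ℝ) ∂(μ.prod ν)
  set G : E × (Fin N → E) → ℝ≥0∞ := fun q =>
    ‖pairMean (h q.1) q.2 - (∫ v, h q.1 v ∂ν) ^ 2‖ₑ ^ (p / 2 : ℝ)
  have hG : Measurable G := (measurable_pairMean_sub_sq hh ν).enorm.pow_const _
  have hterm (a : Fin (N + 1)) : ∫⁻ x : Fin (N + 1) → E, G (x a, fun j => x (a.succAbove j))
      ∂(Measure.pi fun _ => μ) ≤ K * I := by
    rw [lintegral_pi_succAbove μ a hG]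
    exact lintegral_pairMean_uncurry_sub_sq_rpow_le μ hp1 hp2 hh hL (by simpa using hLN)
  calc _ ≤ ∫⁻ x : Fin (N + 1) → E, ((N + 1 : ℕ) : ℝ≥0∞) ^ (-(p / 2 : ℝ))
          * ∑ a, G (x a, fun j => x (a.succAbove j)) ∂(Measure.pi fun _ => μ) := by
        refine lintegral_mono fun x => ?_
        rw [crossMean_sub_expect x fun y => (∫ v, h y v ∂ν) ^ 2]
        simpa only [Fintype.card_fin] using enorm_expect_rpow_le hq0 hq1 fun a =>
          pairMean (h (x a)) (fun j => x (a.succAbove j)) - (∫ v, h (x a) v ∂ν) ^ 2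
    _ = ((N + 1 : ℕ) : ℝ≥0∞) ^ (-(p / 2 : ℝ)) * ∑ a, ∫⁻ x : Fin (N + 1) → E,
          G (x a, fun j => x (a.succAbove j)) ∂(Measure.pi fun _ => μ) := by
        rw [lintegral_const_mul _ (by fun_prop), lintegral_finsetSum _ fun a _ => by fun_prop]
    _ ≤ ((N + 1 : ℕ) : ℝ≥0∞) ^ (-(p / 2 : ℝ)) * ∑ _a : Fin (N + 1), K * I := by
        gcongr with a
        exact hterm a
    _ = _ := by
        rw [Finset.sum_const, Finset.card_univ, Fintype.card_fin, nsmul_eq_mul, ← mul_assoc,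
          ← mul_assoc, sub_eq_neg_add, ENNReal.rpow_add _ _ (by simp) (ENNReal.natCast_ne_top _),
          ENNReal.rpow_one]

end CrossMean

section Convergence

lemma tendsto_rpow_mul_rpow_div_zero {p : ℝ} (hp1 : 3 / 2 < p) (hp2 : p ≤ 2) {d : ℕ} (hd : 0 < d) :
    Tendsto (fun N : ℕ => ((N + 1 : ℕ) : ℝ≥0∞) ^ (1 - p / 2)
      * (48 * ((N / d : ℕ) : ℝ≥0∞) ^ (p⁻¹ - 1)) ^ (p / 2)) atTop (𝓝 0) := by
  have hL : Tendsto (fun N : ℕ => ((N / d : ℕ) : ℝ≥0∞)⁻¹ ^ (p - 3 / 2)) atTop (𝓝 0) := by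
    have := (ENNReal.tendsto_inv_nat_nhds_zero.comp
      (Nat.tendsto_div_const_atTop hd.ne')).ennrpow_const (p - 3 / 2)
    rwa [ENNReal.zero_rpow_of_pos (by linarith)] at this
  have hlim : Tendsto (fun N : ℕ => ((2 * d : ℕ) : ℝ≥0∞) ^ (1 - p / 2) * 48 ^ (p / 2)
      * ((N / d : ℕ) : ℝ≥0∞)⁻¹ ^ (p - 3 / 2)) atTop (𝓝 0) := by
    have hC : ((2 * d : ℕ) : ℝ≥0∞) ^ (1 - p / 2) * 48 ^ (p / 2) ≠ ∞ := by finiteness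
    simpa using ENNReal.Tendsto.const_mul hL (Or.inr hC)
  refine tendsto_of_tendsto_of_tendsto_of_le_of_le' tendsto_const_nhds hlim
    (Eventually.of_forall fun _ => zero_le) ?_
  filter_upwards [eventually_ge_atTop d] with N hN
  set L := N / d
  have hL0 : 0 < L := Nat.div_pos hN hd
  have hNL : N + 1 ≤ 2 * d * L := by
    have hdiv : N < d * (L + 1) := Nat.lt_mul_div_succ N hd
    nlinarith
  have hexp : (1 - p / 2) + (p⁻¹ - 1) * (p / 2) = -(p - 3 / 2) := by
    field_simp
    ring
  calc _ ≤ ((2 * d * L : ℕ) : ℝ≥0∞) ^ (1 - p / 2) * (48 * (L : ℝ≥0∞) ^ (p⁻¹ - 1)) ^ (p / 2) := by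
        gcongr
        linarith
    _ = ((2 * d : ℕ) : ℝ≥0∞) ^ (1 - p / 2) * 48 ^ (p / 2)
          * ((L : ℝ≥0∞) ^ (1 - p / 2) * (L : ℝ≥0∞) ^ ((p⁻¹ - 1) * (p / 2))) := by
        rw [Nat.cast_mul, ENNReal.mul_rpow_of_nonneg _ _ (by linarith),
          ENNReal.mul_rpow_of_nonneg _ _ (by linarith), ← ENNReal.rpow_mul]
        ring
    _ = _ := by
        rw [← ENNReal.rpow_add _ _ (by exact_mod_cast hL0.ne') (ENNReal.natCast_ne_top _), hexp,
          ENNReal.rpow_neg, ENNReal.inv_rpow]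

variable {Ω E : Type*} [MeasurableSpace Ω] [MeasurableSpace E] {P : Measure Ω} {X : ℕ → Ω → E}

lemma map_fin_eq_pi_map (hX_indep : iIndepFun X P) (hX_ident : ∀ i, IdentDistrib (X i) (X 0) P P)
    (n : ℕ) : P.map (fun ω (i : Fin n) => X i ω) = Measure.pi fun _ => P.map (X 0) := by
  refine (iIndepFun.map_fun_eq_pi_map (f := fun i : Fin n => X i)
    (fun i => (hX_ident i).aemeasurable_fst) (hX_indep.precomp Fin.val_injective)).trans ?_
  congr with i : 1
  exact (hX_ident i).map_eq

lemma tendstoInMeasure_of_tendsto_lintegral_rpow {ι : Type*} {l : Filter ι} {q : ℝ≥0} (hq : q ≠ 0)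
    {f : ι → Ω → ℝ} (hf : ∀ i, AEStronglyMeasurable (f i) P)
    (hlim : Tendsto (fun i => ∫⁻ ω, ‖f i ω‖ₑ ^ (q : ℝ) ∂P) l (𝓝 0)) :
    TendstoInMeasure P f l fun _ => 0 := by
  have hq0 : (0 : ℝ) < q := by exact_mod_cast pos_iff_ne_zero.2 hq
  refine tendstoInMeasure_of_tendsto_eLpNorm (p := q) (by simpa using hq) hf
    aestronglyMeasurable_const ?_
  have hroot := hlim.ennrpow_const (q : ℝ)⁻¹
  rw [ENNReal.zero_rpow_of_pos (inv_pos.2 hq0)] at hroot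
  refine hroot.congr fun i => ?_
  rw [← eLpNorm_nnreal_pow_eq_lintegral hq, ENNReal.rpow_rpow_inv hq0.ne']
  exact congrArg (fun g => eLpNorm g q P) (sub_zero (f i)).symm

variable {κ : Type*} [Fintype κ] {h : E → (κ → E) → ℝ}

lemma tendsto_lintegral_crossMean_sub_expect_sq_rpow (μ : Measure E) [IsProbabilityMeasure μ]
    (hh : Measurable (Function.uncurry h)) {p : ℝ≥0} (hp1 : 3 / 2 < p) (hp2 : p ≤ 2)
    (hmoment : MemLp (Function.uncurry h) p (μ.prod (Measure.pi fun _ => μ))) :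
    Tendsto (fun N : ℕ => ∫⁻ x : Fin (N + 1) → E,
      ‖crossMean h x - 𝔼 a, (∫ v, h (x a) v ∂(Measure.pi fun _ => μ)) ^ 2‖ₑ ^ (p / 2 : ℝ)
        ∂(Measure.pi fun _ => μ)) atTop (𝓝 0) := by
  have hp : 1 ≤ p := ((one_le_div two_pos).2 (by norm_num)).trans hp1.le
  set d := 2 * (Fintype.card κ + 1) with hd
  have hrate := tendsto_rpow_mul_rpow_div_zero (p := p) (by exact_mod_cast hp1)
    (by exact_mod_cast hp2) (d := d) (by omega)
  have hfinite : ∫⁻ q, ‖Function.uncurry h q‖ₑ ^ (p : ℝ) ∂(μ.prod (Measure.pi fun _ => μ)) ≠ ∞ := by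
    rw [← eLpNorm_nnreal_pow_eq_lintegral (zero_lt_one.trans_le hp).ne']
    exact ENNReal.rpow_ne_top_of_nonneg p.2 hmoment.eLpNorm_ne_top
  have hbound := ENNReal.Tendsto.mul_const hrate (Or.inr hfinite)
  rw [zero_mul] at hbound
  refine tendsto_of_tendsto_of_tendsto_of_le_of_le' tendsto_const_nhds hbound
    (Eventually.of_forall fun _ => zero_le) ?_
  filter_upwards [eventually_ge_atTop d] with N hN
  refine lintegral_crossMean_sub_expect_sq_rpow_le μ hp hp2 hh (Nat.div_pos hN (by omega)) ?_
  have := Nat.div_mul_le_self N d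
  nlinarith

lemma tendstoInMeasure_crossMean_sub_expect_sq [IsProbabilityMeasure P] (hX_indep : iIndepFun X P)
    (hX_ident : ∀ i, IdentDistrib (X i) (X 0) P P) (hh : Measurable (Function.uncurry h))
    {p : ℝ≥0} (hp1 : 3 / 2 < p) (hp2 : p ≤ 2) (hmoment : MemLp (Function.uncurry h) p
      ((P.map (X 0)).prod (Measure.pi fun _ => P.map (X 0)))) :
    TendstoInMeasure P (fun (N : ℕ) ω => crossMean h (fun i : Fin (N + 1) => X i ω)
      - 𝔼 a : Fin (N + 1), (∫ v, h (X a ω) v ∂(Measure.pi fun _ => P.map (X 0))) ^ 2)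
      atTop fun _ => 0 := by
  have hX (i : ℕ) : AEMeasurable (X i) P := (hX_ident i).aemeasurable_fst
  have : IsProbabilityMeasure (P.map (X 0)) := Measure.isProbabilityMeasure_map (hX 0)
  have hobs (N : ℕ) : AEMeasurable (fun ω (i : Fin (N + 1)) => X i ω) P :=
    aemeasurable_pi_lambda _ fun i => hX i
  have hD (N : ℕ) :=
    measurable_crossMean_sub_expect_sq (N := N) hh (Measure.pi fun _ => P.map (X 0))
  refine tendstoInMeasure_of_tendsto_lintegral_rpow (q := p / 2)
    (half_pos ((by norm_num : (0 : ℝ≥0) < 3 / 2).trans hp1)).ne'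
    (fun N => ((hD N).comp_aemeasurable (hobs N)).aestronglyMeasurable) ?_
  rw [NNReal.coe_div, NNReal.coe_two]
  refine (tendsto_lintegral_crossMean_sub_expect_sq_rpow _ hh hp1 hp2 hmoment).congr fun N => ?_
  rw [← map_fin_eq_pi_map hX_indep hX_ident,
    lintegral_map' ((hD N).enorm.pow_const _).aemeasurable (hobs N)]

end Convergence

section CrossStat

/-- The positions `(i_1, …, i_{2m-1})` with `m = k + 1`, split as the shared position `i_1`, the
block `i_2, …, i_m` and the block `i_{m+1}, …, i_{2m-1}`. It translates the indexing of `crossStat`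
into that of `crossMean`. -/
noncomputable def positionEquiv (k : ℕ) : Option (Fin k ⊕ Fin k) ≃ Fin (2 * (k + 1) - 1) :=
  Equiv.ofBijective
    (fun o => o.elim ⟨0, by omega⟩
      (Sum.elim (fun j => ⟨j + 1, by omega⟩) fun j => ⟨k + 1 + j, by omega⟩)) <| by
    refine (Fintype.bijective_iff_injective_and_card _).2 ⟨?_, ?_⟩
    · rintro (_ | i | i) (_ | j | j) h <;> simp [Fin.ext_iff] at h ⊢ <;> omega
    · simp only [Fintype.card_option, Fintype.card_sum, Fintype.card_fin]
      omega

lemma leftPos_zero (k : ℕ) : leftPos (k + 1) 0 = positionEquiv k none := rfl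

lemma leftPos_succ {k : ℕ} (j : Fin k) :
    leftPos (k + 1) j.succ = positionEquiv k (some (.inl j)) := rfl

lemma rightPos_zero (k : ℕ) : rightPos (k + 1) 0 = positionEquiv k none := rfl

lemma rightPos_succ {k : ℕ} (j : Fin k) :
    rightPos (k + 1) j.succ = positionEquiv k (some (.inr j)) := by
  refine Fin.ext ?_
  simp only [rightPos, positionEquiv, Fin.val_succ, Equiv.ofBijective_apply, Option.elim_some,
    Sum.elim_inr, Nat.succ_ne_zero, if_false]
  omega

lemma invFalling_mul_sum_embedding {n k : ℕ} (G : (Fin k ↪ Fin n) → ℝ) :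
    invFalling n k * ∑ f, G f = 𝔼 f, G f := by
  rcases le_or_gt k n with hk | hk
  · have hcard : (n.factorial : ℝ) = (n - k).factorial * n.descFactorial k := by
      exact_mod_cast (Nat.factorial_mul_descFactorial hk).symm
    rw [Fintype.expect_eq_sum_div_card, Fintype.card_embedding_eq, Fintype.card_fin,
      Fintype.card_fin, invFalling, hcard, div_mul_cancel_left₀ (by positivity), inv_mul_eq_div]
  · have : IsEmpty (Fin k ↪ Fin n) :=
      ⟨fun f => hk.not_ge (by simpa using Fintype.card_le_of_embedding f)⟩
    simp

lemma crossStat_eq_crossMean {Ω : Type*} [MeasurableSpace Ω] (X : ℕ → Ω → ℝ) {k : ℕ}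
    (h : (Fin (k + 1) → ℝ) → ℝ) (n : ℕ) (ω : Ω) :
    crossStat X h n ω = crossMean (fun x v => h (Fin.cons x v)) fun i : Fin n => X i ω := by
  rw [crossStat, invFalling_mul_sum_embedding]
  refine Fintype.expect_equiv (Equiv.embeddingCongr (positionEquiv k).symm (Equiv.refl _)) _ _
    fun i => ?_
  congr 2 <;> ext j <;> cases j using Fin.cases <;>
    simp [leftPos_zero, leftPos_succ, rightPos_zero, rightPos_succ]

end CrossStat

section Projection

lemma memLp_of_integrable_abs_rpow {Ω : Type*} [MeasurableSpace Ω] {P : Measure Ω}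
    [IsFiniteMeasure P] {Y : Ω → ℝ} (hY : AEStronglyMeasurable Y P) {p : ℝ} {q : ℝ≥0} (hq : 0 < q)
    (hqp : q ≤ p) (hint : Integrable (fun ω => |Y ω| ^ p) P) : MemLp Y q P := by
  rw [← integrable_norm_rpow_iff hY (by simpa using hq.ne') ENNReal.coe_ne_top]
  exact integrable_norm_rpow_of_le hY q.coe_nonneg (q.coe_nonneg.trans hqp) hqp hint

lemma measurable_finCons {E : Type*} [MeasurableSpace E] {k : ℕ} :
    Measurable fun q : E × (Fin k → E) => (Fin.cons q.1 q.2 : Fin (k + 1) → E) := by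
  refine measurable_pi_lambda _ (Fin.cases measurable_fst fun i => ?_)
  exact (measurable_pi_apply i).comp measurable_snd

lemma firstObs_succ {Ω : Type*} (k : ℕ) (X : ℕ → Ω → ℝ) (ω : Ω) :
    firstObs (k + 1) X ω = Fin.cons (X 0 ω) fun j : Fin k => X (j + 1) ω := by
  ext j
  cases j using Fin.cases <;> rfl

lemma condDistrib_ae_eq_of_map_prodMk_eq_prod {Ω β γ δ : Type*} [MeasurableSpace Ω]
    [MeasurableSpace β] [MeasurableSpace γ] [MeasurableSpace δ] [StandardBorelSpace δ] [Nonempty δ]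
    {P : Measure Ω} [IsFiniteMeasure P] {X : Ω → β} {Y : Ω → γ} {ν : Measure γ} [IsFiniteMeasure ν]
    (hX : AEMeasurable X P) (hY : AEMeasurable Y P)
    (hXY : P.map (fun ω => (X ω, Y ω)) = (P.map X).prod ν) {Φ : β × γ → δ} (hΦ : Measurable Φ) :
    condDistrib (fun ω => Φ (X ω, Y ω)) X P
      =ᵐ[P.map X] fun x => ν.map fun y => Φ (x, y) := by
  let κ : Kernel β δ := (Kernel.id ×ₖ Kernel.const β ν).map Φ
  have hκ (x : β) : κ x = ν.map fun y => Φ (x, y) := by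
    rw [Kernel.map_apply _ hΦ, Kernel.prod_apply, Kernel.id_apply, Kernel.const_apply,
      Measure.dirac_prod, Measure.map_map hΦ measurable_prodMk_left]
    rfl
  have hlaw : P.map (fun ω => (X ω, Φ (X ω, Y ω))) = P.map X ⊗ₘ κ := by
    have hpair : Measurable fun q : β × γ => (q.1, Φ q) := measurable_fst.prodMk hΦ
    calc P.map (fun ω => (X ω, Φ (X ω, Y ω)))
        = (P.map fun ω => (X ω, Y ω)).map fun q => (q.1, Φ q) :=
          (AEMeasurable.map_map_of_aemeasurable hpair.aemeasurable (hX.prodMk hY)).symm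
      _ = P.map X ⊗ₘ κ := by
        ext s hs
        rw [hXY, Measure.map_apply hpair hs, Measure.prod_apply (hpair hs),
          Measure.compProd_apply hs]
        refine lintegral_congr fun x => ?_
        rw [hκ, Measure.map_apply (by fun_prop) (measurable_prodMk_left hs)]
        rfl
  have hΦXY : AEMeasurable (fun ω => Φ (X ω, Y ω)) P := hΦ.comp_aemeasurable (hX.prodMk hY)
  filter_upwards [condDistrib_ae_eq_of_measure_eq_compProd X hΦXY hlaw] with x hx
  rw [hx, hκ]

variable {Ω : Type*} [MeasurableSpace Ω] {P : Measure Ω} [IsProbabilityMeasure P] {X : ℕ → Ω → ℝ}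
  {k : ℕ} {h : (Fin (k + 1) → ℝ) → ℝ}

lemma map_head_tail_eq_prod (hX_indep : iIndepFun X P)
    (hX_ident : ∀ i, IdentDistrib (X i) (X 0) P P) (k : ℕ) :
    P.map (fun ω => (X 0 ω, fun j : Fin k => X (j + 1) ω))
      = (P.map (X 0)).prod (Measure.pi fun _ => P.map (X 0)) := by
  have hsplit := measurePreserving_piFinSuccAbove (fun _ : Fin (k + 1) => P.map (X 0)) 0
  rw [← hsplit.map_eq, ← map_fin_eq_pi_map hX_indep hX_ident,
    AEMeasurable.map_map_of_aemeasurable hsplit.measurable.aemeasurable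
      (aemeasurable_pi_lambda _ fun j => (hX_ident j).aemeasurable_fst)]
  rfl

lemma proj_ae_eq_integral_section (hX_indep : iIndepFun X P)
    (hX_ident : ∀ i, IdentDistrib (X i) (X 0) P P) (hh : Measurable h) (hθ : theta P X h = 0) :
    proj P X h =ᵐ[P.map (X 0)]
      fun x => ∫ v, h (Fin.cons x v) ∂(Measure.pi fun _ => P.map (X 0)) := by
  have hcond := condDistrib_ae_eq_of_map_prodMk_eq_prod (hX_ident 0).aemeasurable_fst
    (aemeasurable_pi_lambda _ fun j : Fin k => (hX_ident (j + 1)).aemeasurable_fst)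
    (map_head_tail_eq_prod hX_indep hX_ident k) measurable_finCons
  filter_upwards [hcond] with x hx
  have hcons : Measurable fun v : Fin k → ℝ => (Fin.cons x v : Fin (k + 1) → ℝ) :=
    measurable_finCons.comp measurable_prodMk_left
  simp only [← firstObs_succ] at hx
  rw [proj, hθ, hx, integral_map hcons.aemeasurable (hh.sub_const 0).aestronglyMeasurable]
  simp only [sub_zero]

lemma ae_forall_proj_eq_integral_section (hX_indep : iIndepFun X P)
    (hX_ident : ∀ i, IdentDistrib (X i) (X 0) P P) (hh : Measurable h) (hθ : theta P X h = 0) :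
    ∀ᵐ ω ∂P, ∀ i, proj P X h (X i ω)
      = ∫ v, h (Fin.cons (X i ω) v) ∂(Measure.pi fun _ => P.map (X 0)) := by
  have hproj := proj_ae_eq_integral_section hX_indep hX_ident hh hθ
  refine ae_all_iff.2 fun i => ?_
  refine ae_of_ae_map (hX_ident i).aemeasurable_fst
    (p := fun x => proj P X h x = ∫ v, h (Fin.cons x v) ∂(Measure.pi fun _ => P.map (X 0))) ?_
  rwa [(hX_ident i).map_eq]

lemma measurable_uncurry_section (hh : Measurable h) :
    Measurable (Function.uncurry fun x (v : Fin k → ℝ) => h (Fin.cons x v)) :=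
  hh.comp measurable_finCons

lemma memLp_uncurry_section (hX_indep : iIndepFun X P)
    (hX_ident : ∀ i, IdentDistrib (X i) (X 0) P P) (hh : Measurable h) {p : ℝ≥0∞}
    (hmoment : MemLp (fun ω => h (firstObs (k + 1) X ω)) p P) :
    MemLp (Function.uncurry fun x (v : Fin k → ℝ) => h (Fin.cons x v)) p
      ((P.map (X 0)).prod (Measure.pi fun _ => P.map (X 0))) := by
  rw [← map_head_tail_eq_prod hX_indep hX_ident, memLp_map_measure_iff
    (measurable_uncurry_section hh).aestronglyMeasurable ((hX_ident 0).aemeasurable_fst.prodMk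
      (aemeasurable_pi_lambda _ fun j => (hX_ident (j + 1)).aemeasurable_fst))]
  simp only [firstObs_succ] at hmoment
  exact hmoment

lemma tendstoInMeasure_crossStat_succ_sub_expect (hX_indep : iIndepFun X P)
    (hX_ident : ∀ i, IdentDistrib (X i) (X 0) P P) (hh : Measurable h) {p : ℝ≥0} (hp1 : 3 / 2 < p)
    (hp2 : p ≤ 2) (hmoment : MemLp (fun ω => h (firstObs (k + 1) X ω)) p P)
    (hθ : theta P X h = 0) :
    TendstoInMeasure P
      (fun (N : ℕ) ω => crossStat X h (N + 1) ω - 𝔼 a : Fin (N + 1), proj P X h (X a ω) ^ 2)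
      atTop fun _ => 0 := by
  refine (tendstoInMeasure_crossMean_sub_expect_sq hX_indep hX_ident
    (measurable_uncurry_section hh) hp1 hp2
    (memLp_uncurry_section hX_indep hX_ident hh hmoment)).congr_left fun N => ?_
  filter_upwards [ae_forall_proj_eq_integral_section hX_indep hX_ident hh hθ] with ω hω
  simp only [crossStat_eq_crossMean, hω]

end Projection

end UStat

theorem theorem2_general {Ω : Type*} [MeasurableSpace Ω] (P : Measure Ω) [IsProbabilityMeasure P]
    (X : ℕ → Ω → ℝ) (hX_indep : iIndepFun X P) (hX_ident : ∀ i, IdentDistrib (X i) (X 0) P P)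
    (m : ℕ) (hm : 1 ≤ m) (h : (Fin m → ℝ) → ℝ) (hh_meas : Measurable h) {p : ℝ} (hp : 3 / 2 < p)
    (hh_moment : Integrable (fun ω => |h (UStat.firstObs m X ω)| ^ p) P)
    (hθ : UStat.theta P X h = 0) :
    TendstoInMeasure P
      (fun (n : ℕ) (ω : Ω) =>
        |UStat.crossStat X h n ω
          - (1 / (n : ℝ)) * ∑ i ∈ Finset.range n, (UStat.proj P X h (X i ω)) ^ 2|)
      atTop (fun _ => (0 : ℝ)) := by
  obtain ⟨k, rfl⟩ := Nat.exists_eq_add_of_le' hm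
  have hmeas : AEStronglyMeasurable (fun ω => h (UStat.firstObs (k + 1) X ω)) P :=
    (hh_meas.comp_aemeasurable
      (aemeasurable_pi_lambda _ fun j => (hX_ident j).aemeasurable_fst)).aestronglyMeasurable
  obtain ⟨q, hq, hqp, hq2⟩ : ∃ q : ℝ≥0, 3 / 2 < q ∧ (q : ℝ) ≤ p ∧ q ≤ 2 :=
    ⟨min p.toNNReal 2, lt_min (by simpa [Real.lt_toNNReal_iff_coe_lt] using hp)
      (by norm_num [← NNReal.coe_lt_coe]), by simp [show 0 ≤ p by linarith],
      min_le_right _ _⟩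
  have hlim := UStat.tendstoInMeasure_crossStat_succ_sub_expect hX_indep hX_ident hh_meas hq hq2
    (UStat.memLp_of_integrable_abs_rpow hmeas (pos_of_gt hq) hqp hh_moment) hθ
  rw [tendstoInMeasure_iff_norm] at hlim ⊢
  intro ε hε
  refine (tendsto_add_atTop_iff_nat 1).1 ((hlim ε hε).congr fun N => ?_)
  simp [Fintype.expect_eq_sum_div_card, Finset.sum_range, div_eq_inv_mul]

theorem theorem2 {Ω : Type*} [MeasurableSpace Ω] (P : Measure Ω) [IsProbabilityMeasure P]
    (X : ℕ → Ω → ℝ) (hX_meas : ∀ i, Measurable (X i)) (hX_indep : iIndepFun X P)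
    (hX_ident : ∀ i, IdentDistrib (X i) (X 0) P P)
    (m : ℕ) (hm : 1 ≤ m) (h : (Fin m → ℝ) → ℝ) (hh_meas : Measurable h)
    (hh_symm : UStat.IsSymmKernel h)
    (hh_moment : Integrable (fun ω => |h (UStat.firstObs m X ω)| ^ (5 / 3 : ℝ)) P)
    (hθ : UStat.theta P X h = 0)
    (hDAN : UStat.IsDAN P (fun i ω => UStat.proj P X h (X i ω))) :
    TendstoInMeasure P
      (fun (n : ℕ) (ω : Ω) =>
        |UStat.crossStat X h n ω
          - (1 / (n : ℝ)) * ∑ i ∈ Finset.range n, (UStat.proj P X h (X i ω)) ^ 2|)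
      atTop (fun _ => (0 : ℝ)) :=
  theorem2_general P X hX_indep hX_ident m hm h hh_meas (by norm_num) hh_moment hθ
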